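/- Let $k=p_1p_2\cdots p_d$ with $d\ge 2$ be a product of pairwise distinct primes, and put $c_1=1$, $c_i=p_1\cdots p_{i-1}$ for $2\le i\le d$. For each $i$ let $g_i:\{0,\dots,p_i-1\}\times\mathbb Z\to\mathbb Z$ be an admissible function, i.e. $g_i(j,n)$ is periodic in $n$ with period $p_i$ and, for all $0\le u<v\le p_i-1$, $$\{(g_i(v,n)-g_i(u,n)) \bmod p_i : 0\le n\le p_i-1\}=\{0,1,\dots,p_i-1\},$$ and let $(a_i(n))_{n\ge0}$ be a sequence of integers with $$a_i(p_in+j)=a_i(n)+g_i(j,n)\qquad (n\ge 1,\ 0\le j\le p_i-1).$$ Let $\hat a(n)=\bigl(c_1a_1(n)+\cdots+c_da_d(n)\bigr)\bmod k\in\{0,\dots,k-1\}$, and let $\delta(m,n)=0$ if $\hat a(m)=\hat a(n)$ and $\delta(m,n)=1$ otherwise. Then for all integers $0\le r_1<r_2$, all real $0<\gamma<1$ and all integers $N\ge 0$, $$\sum_{n<N}\delta(n+r_1,n+r_2)=\Bigl(1-\frac1k\Bigr)N+O_k\Bigl((r_2-r_1)N^{1-\gamma/d}+(r_2-r_1)N^{1-\gamma}\log^+\frac{N^{\gamma/d}}{r_2-r_1}+N^{\gamma}+r_1\Bigr),$$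 where $\log^+x=\max(0,\log x)$ for $x>0$, $\log^+0=0$, and the implied constant depends only on $k$ (not on the $g_i$, the $a_i$, $\gamma$, $r_1$, $r_2$ or $N$). -/

import Mathlib

namespace RudinShapiro

/-- The discrete correlation coefficient of order two of a word `x`. -/
def delta (x : ℕ → ℤ) (i j : ℕ) : ℕ :=
  if x i = x j then 0 else 1

/-- `g : {0, …, k-1} × ℤ → ℤ` is admissible: it is `k`-periodic in its second argument, and for
all `u < v` the differences `g(v, n) - g(u, n)`, reduced mod `k`, `0 ≤ n ≤ k-1`, fill
`{0, …, k-1}`. -/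
structure Admissible (k : ℕ) (g : Fin k → ℤ → ℤ) : Prop where
  periodic : ∀ (j : Fin k) (n : ℤ), g j (n + k) = g j n
  differences : ∀ u v : Fin k, u < v →
    (fun n : ℤ => (g v n - g u n) % (k : ℤ)) '' Set.Ico (0 : ℤ) k = Set.Ico (0 : ℤ) k

/-- The digit recursion in base `k`; the initial values `a 0, …, a (k-1)` are arbitrary. -/
def DigitRecursion (k : ℕ) (g : Fin k → ℤ → ℤ) (a : ℕ → ℤ) : Prop :=
  ∀ n : ℕ, 1 ≤ n → ∀ j : Fin k, a (k * n + j) = a n + g j n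

/-- The weight of index `i`: the product of the `p j` with `j < i` (an empty product is `1`). -/
def weight {d : ℕ} (p : Fin d → ℕ) (i : Fin d) : ℕ :=
  ∏ j ∈ Finset.Iio i, p j

/-- The combined sequence: the weighted sum of the `a i`, reduced modulo the product of
the `p i`. -/
def combined {d : ℕ} (p : Fin d → ℕ) (a : Fin d → ℕ → ℤ) (n : ℕ) : ℤ :=
  (∑ i, (weight p i : ℤ) * a i n) % ((∏ i, p i : ℕ) : ℤ)

end RudinShapiro

namespace RudinShapiro

/-! In one base `p`, suppose that adding `r` to `n` changes digit `j` but no higher digit. Then `n`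
and `n + r` have digits `u < v` there, and the next digit `y` of `n` enters the increment of `a`
only through `g v y - g u y`. By admissibility, every residue mod `p` occurs exactly once as `y`
varies. Hence, among `n` whose carry stays within the `W` lowest digits, the increment is exactly
uniform mod `p` (`DigitRecursion.equidistributed`), and it depends only on `n` mod `p ^ (W + 1)`
(`DigitRecursion.increment_eq`).

For distinct primes these moduli are coprime, so the increments are independent, and the mixed radix
weights make the combined increment uniform mod `k` (`sum_weight_equidistributed`). Thus in
`sum_block_eq` coincidences have proportion exactly `1 / k`. The only errors are incomplete blocks
and long carries (`abs_sum_delta_sub_le`). Windows `p i ^ W i` of size about `N ^ (γ / d)` balance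
them; the logarithmic term is never needed. -/

/-! ### Increments of a digit recursion in a single base. -/

theorem sum_range_mul_eq (m c : ℕ) (F : ℕ → ℝ) :
    ∑ n ∈ Finset.range (m * c), F n =
      ∑ y ∈ Finset.range c, ∑ x ∈ Finset.range m, F (m * y + x) := by
  induction c with
  | zero => simp
  | succ c ih => rw [Nat.mul_succ, Finset.sum_range_add, ih, Finset.sum_range_succ]

theorem Admissible.congr {p : ℕ} {g : Fin p → ℤ → ℤ} (hg : Admissible p g) (j : Fin p)
    {m n : ℤ} (h : m ≡ n [ZMOD p]) : g j m = g j n := by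
  obtain ⟨t, ht⟩ := h.dvd
  have hp : Function.Periodic (g j) (p : ℤ) := hg.periodic j
  have := hp.int_mul t m
  rw [← this]
  congr 1
  simp only [Int.cast_id]
  linarith

/-- Appending a fixed block of digits to `m` changes the value by an amount that depends only on
the last digit of `m`. -/
theorem DigitRecursion.sub_eq {p : ℕ} {g : Fin p → ℤ → ℤ} {a : ℕ → ℤ} (hg : Admissible p g)
    (ha : DigitRecursion p g a) (hp : 0 < p) (L : ℕ) :
    ∀ m m' s : ℕ, 1 ≤ m → 1 ≤ m' → (m : ℤ) ≡ m' [ZMOD p] → s < p ^ L →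
      a (p ^ L * m + s) - a m = a (p ^ L * m' + s) - a m' := by
  induction L with
  | zero =>
    intro m m' s _ _ _ hs
    have : s = 0 := by simpa using hs
    simp [this]
  | succ L ih =>
    intro m m' s hm hm' hmod hs
    have hs' : s / p < p ^ L := by
      rw [Nat.div_lt_iff_lt_mul hp, ← pow_succ]; exact hs
    have key : ∀ n : ℕ, 1 ≤ n → a (p ^ (L + 1) * n + s) =
        a (p ^ L * n + s / p) + g ⟨s % p, Nat.mod_lt _ hp⟩ ((p ^ L * n + s / p : ℕ) : ℤ) := by
      intro n hn
      have hpos : 0 < p ^ L * n := Nat.mul_pos (pow_pos hp L) hn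
      rw [← ha _ (by have := Nat.zero_le (s / p); linarith)]
      congr 1
      have := Nat.div_add_mod s p
      simp only
      calc p ^ (L + 1) * n + s = p ^ (L + 1) * n + (p * (s / p) + s % p) := by rw [this]
        _ = _ := by ring
    rw [key m hm, key m' hm']
    have h1 := ih m m' (s / p) hm hm' hmod hs'
    have h2 : g ⟨s % p, Nat.mod_lt _ hp⟩ ((p ^ L * m + s / p : ℕ) : ℤ) =
        g ⟨s % p, Nat.mod_lt _ hp⟩ ((p ^ L * m' + s / p : ℕ) : ℤ) := by
      apply hg.congr
      push_cast
      exact (hmod.mul_left _).add_right _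
    linarith

/-- The difference of two columns of an admissible function takes each residue, shifted by any
constant, exactly once over a period. -/
theorem Admissible.sum_ite_eq_one {p : ℕ} {g : Fin p → ℤ → ℤ} (hg : Admissible p g)
    {u v : Fin p} (huv : u < v) (c : ℤ) :
    ∑ y ∈ Finset.range p, (if (p : ℤ) ∣ g v y - g u y - c then (1 : ℝ) else 0) = 1 := by
  have hp : 0 < p := u.pos
  have hpz : (0 : ℤ) < p := by exact_mod_cast hp
  set F : Fin p → Fin p := fun y =>
    ⟨((g v (y : ℕ) - g u (y : ℕ)) % p).toNat, by
      have := Int.emod_lt_of_pos (g v (y : ℕ) - g u (y : ℕ)) hpz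
      omega⟩ with hF
  have hsurj : Function.Surjective F := by
    intro z
    have hz : ((z : ℕ) : ℤ) ∈ Set.Ico (0 : ℤ) p := ⟨by positivity, by exact_mod_cast z.2⟩
    rw [← hg.differences u v huv] at hz
    obtain ⟨n, ⟨hn0, hn1⟩, hn⟩ := hz
    refine ⟨⟨n.toNat, by omega⟩, ?_⟩
    apply Fin.ext
    simp only [hF]
    rw [Int.toNat_of_nonneg hn0]
    simp only at hn
    rw [hn]
    simp
  have hinj : Function.Injective F := Finite.injective_iff_surjective.mpr hsurj
  have hc0 := Int.emod_nonneg c hpz.ne'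
  have hc1 := Int.emod_lt_of_pos c hpz
  obtain ⟨y₀, hy₀⟩ := hsurj ⟨(c % p).toNat, by omega⟩
  have hiff : ∀ y : Fin p, (p : ℤ) ∣ g v (y : ℕ) - g u (y : ℕ) - c ↔ y = y₀ := by
    intro y
    rw [← hinj.eq_iff, hy₀, Fin.ext_iff]
    simp only [hF]
    have h0 := Int.emod_nonneg (g v (y : ℕ) - g u (y : ℕ)) hpz.ne'
    rw [← Int.modEq_iff_dvd, Int.ModEq]
    omega
  rw [Finset.sum_range]
  simp [hiff]

/-- If the shift by `r` carries into digit `W` of `x` but not beyond, then the increment of `a`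
from `x` to `x + r` takes each residue exactly once as the next digit varies. -/
theorem DigitRecursion.sum_ite_eq_one {p : ℕ} {g : Fin p → ℤ → ℤ} {a : ℕ → ℤ}
    (hg : Admissible p g) (ha : DigitRecursion p g a) (hp : 0 < p) {W r x v : ℕ} (hv : 1 ≤ v)
    (hx : x + r < p ^ W * p) (hcarry : p ^ W ≤ x % p ^ W + r) (z : ℤ) :
    ∑ y ∈ Finset.range p, (if (p : ℤ) ∣ a (p ^ W * p * (p * v + y) + x + r) -
      a (p ^ W * p * (p * v + y) + x) - z then (1 : ℝ) else 0) = 1 := by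
  have hP : 0 < p ^ W := pow_pos hp W
  have hu : ∀ x < p ^ W * p, x / p ^ W < p := fun x hx => by
    rw [Nat.div_lt_iff_lt_mul hP, mul_comm]; exact hx
  have key : ∀ x, ∀ hx : x < p ^ W * p, ∃ c : ℤ, ∀ m : ℕ, 1 ≤ m →
      a (p ^ W * p * m + x) = a m + g ⟨x / p ^ W, hu x hx⟩ m + c := by
    intro x hx
    -- The constant is read off at the prefix `1`: the contribution of the low digits depends on the
    -- prefix only through its last digit `x / p ^ W`, so it is the same for all `m`.
    refine ⟨a (p ^ W * (p * 1 + x / p ^ W) + x % p ^ W) - a (p * 1 + x / p ^ W),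
      fun m hm => ?_⟩
    have h1 := ha.sub_eq hg hp W (p * m + x / p ^ W) (p * 1 + x / p ^ W) (x % p ^ W)
      (by nlinarith [Nat.zero_le (x / p ^ W)]) (by nlinarith [Nat.zero_le (x / p ^ W)])
      (by push_cast
          apply Int.ModEq.add_right
          exact (Int.modEq_zero_iff_dvd.2 (dvd_mul_right _ _)).trans
            (Int.modEq_zero_iff_dvd.2 (dvd_mul_right _ _)).symm)
      (Nat.mod_lt _ hP)
    have h2 := ha m hm ⟨x / p ^ W, hu x hx⟩
    simp only at h2
    rw [← h1, ← h2]
    have h3 : p ^ W * p * m + x = p ^ W * (p * m + x / p ^ W) + x % p ^ W := by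
      conv_lhs => rw [← Nat.div_add_mod x (p ^ W)]
      ring
    rw [h3]
    ring
  obtain ⟨c, hc⟩ := key x (by omega)
  obtain ⟨c', hc'⟩ := key (x + r) hx
  -- The carry strictly raises digit `W`, which puts the two columns in the order admissibility asks
  -- for.
  have hlt : (⟨x / p ^ W, hu x (by omega)⟩ : Fin p) < ⟨(x + r) / p ^ W, hu _ hx⟩ := by
    rw [Fin.mk_lt_mk, Nat.lt_iff_add_one_le, Nat.le_div_iff_mul_le hP]
    have := Nat.div_add_mod x (p ^ W)
    nlinarith
  refine (Finset.sum_congr rfl fun y _ => ?_).trans (hg.sum_ite_eq_one hlt (z - c' + c))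
  have hm : 1 ≤ p * v + y := by nlinarith
  have hmod : ((p * v + y : ℕ) : ℤ) ≡ (y : ℤ) [ZMOD p] := by
    push_cast
    simp
  rw [add_assoc, hc _ hm, hc' _ hm, hg.congr _ hmod, hg.congr _ hmod]
  congr 2
  ring

/-- Over one block of length `p ^ (W + 1)`, the increments of `a` along shifts by `r` that do not
carry past digit `W` are equidistributed modulo `p`. -/
theorem DigitRecursion.equidistributed {p : ℕ} {g : Fin p → ℤ → ℤ} {a : ℕ → ℤ}
    (hg : Admissible p g) (ha : DigitRecursion p g a) (hp : 0 < p) {r : ℕ} (hr : 1 ≤ r) (z : ℤ)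
    (W : ℕ) : ∀ v : ℕ, 1 ≤ v →
    (∑ x ∈ Finset.range (p ^ W * p), (if x % p ^ W + r < p ^ W then (1 : ℝ) else 0) *
      (if (p : ℤ) ∣ a (p ^ W * p * v + x + r) - a (p ^ W * p * v + x) - z then 1 else 0)) * p =
    ∑ x ∈ Finset.range (p ^ W * p), (if x % p ^ W + r < p ^ W then (1 : ℝ) else 0) := by
  induction W with
  | zero =>
    intro v _
    -- An empty window admits no positive shift, so both sides vanish.
    have : ¬ r < 1 := by omega
    simp [Nat.mod_one, this]
  | succ W ih =>
    intro v hv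
    have hP : 0 < p ^ W := pow_pos hp W
    set q := p ^ W * p with hq
    have hpow : p ^ (W + 1) = q := pow_succ p W
    rw [hpow, sum_range_mul_eq, sum_range_mul_eq]
    set D : ℕ → ℕ → ℝ := fun y x =>
      if (p : ℤ) ∣ a (q * (p * v + y) + x + r) - a (q * (p * v + y) + x) - z then 1 else 0
      with hD
    set G : ℕ → ℝ := fun x => if x % p ^ W + r < p ^ W then 1 else 0 with hG
    set H : ℕ → ℝ := fun x => if x + r < q ∧ p ^ W ≤ x % p ^ W + r then 1 else 0 with hH
    -- Either the carry already stays in the shorter window (`G`, induction), or it reaches digit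
    -- `W` and stops there (`H`, averaged exactly by the next digit `y`).
    have hsplit : ∀ y, ∀ x ∈ Finset.range q,
        (if (q * y + x) % q + r < q then (1 : ℝ) else 0) = G x + H x := by
      intro y x hx
      have hxq : x < q := Finset.mem_range.1 hx
      rw [Nat.mul_add_mod, Nat.mod_eq_of_lt hxq]
      simp only [hG, hH]
      by_cases h1 : x % p ^ W + r < p ^ W
      · have h2 : x + r < q := by
          have h3 := Nat.div_add_mod x (p ^ W)
          have h4 : x / p ^ W + 1 ≤ p := by
            rw [Nat.succ_le_iff, Nat.div_lt_iff_lt_mul hP, mul_comm]; exact hxq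
          nlinarith
        simp [h1, h2]
      · simp [h1, not_lt.1 h1]
    have hone : ∀ x, H x * ∑ y ∈ Finset.range p, D y x = H x := by
      intro x
      by_cases h : x + r < q ∧ p ^ W ≤ x % p ^ W + r
      · rw [ha.sum_ite_eq_one hg hp hv h.1 h.2 z, mul_one]
      · simp [hH, h]
    have hL : ∑ y ∈ Finset.range p, ∑ x ∈ Finset.range q,
        (if (q * y + x) % q + r < q then (1 : ℝ) else 0) *
          (if (p : ℤ) ∣ a (q * p * v + (q * y + x) + r) - a (q * p * v + (q * y + x)) - z
            then 1 else 0) =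
        ∑ y ∈ Finset.range p, ∑ x ∈ Finset.range q, G x * D y x +
          ∑ x ∈ Finset.range q, H x * ∑ y ∈ Finset.range p, D y x := by
      simp_rw [Finset.mul_sum]
      rw [Finset.sum_comm (s := Finset.range q), ← Finset.sum_add_distrib]
      refine Finset.sum_congr rfl fun y _ => ?_
      rw [← Finset.sum_add_distrib]
      refine Finset.sum_congr rfl fun x hx => ?_
      rw [hsplit y x hx, ← add_mul]
      have : q * p * v + (q * y + x) = q * (p * v + y) + x := by ring
      rw [this]
    have hR : ∑ y ∈ Finset.range p, ∑ x ∈ Finset.range q,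
        (if (q * y + x) % q + r < q then (1 : ℝ) else 0) =
        p * ∑ x ∈ Finset.range q, (G x + H x) := by
      rw [Finset.sum_congr rfl fun y _ => Finset.sum_congr rfl (hsplit y)]
      simp
    rw [hL, hR, Finset.sum_add_distrib]
    simp_rw [hone]
    rw [add_mul, Finset.sum_mul,
      Finset.sum_congr rfl fun y _ => ih (p * v + y) (by nlinarith)]
    simp only [Finset.sum_const, Finset.card_range, nsmul_eq_mul]
    ring

/-- If the shift by `r` does not carry past digit `W`, the increment of `a` depends only on the
residue modulo `p ^ (W + 1)`. -/
theorem DigitRecursion.increment_eq {p : ℕ} {g : Fin p → ℤ → ℤ} {a : ℕ → ℤ}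
    (hg : Admissible p g) (ha : DigitRecursion p g a) (hp : 0 < p) {W r n : ℕ}
    (hn : p ^ W ≤ n) (hgood : n % p ^ W + r < p ^ W) :
    a (n + r) - a n = a (p ^ W * p * 1 + n % (p ^ W * p) + r) -
      a (p ^ W * p * 1 + n % (p ^ W * p)) := by
  have hP : 0 < p ^ W := pow_pos hp W
  -- A representative with the same digits `0, …, W` as `n`; the leading `1` keeps the prefixes
  -- positive, as the recursion requires.
  set n' := p ^ W * p * 1 + n % (p ^ W * p) with hn'
  have hmodn : n' % p ^ W = n % p ^ W := by
    rw [hn', mul_one, Nat.mul_add_mod, Nat.mod_mul_right_mod]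
  have hdiv : n' / p ^ W = p * 1 + n / p ^ W % p := by
    rw [hn', mul_assoc, Nat.mul_add_div hP, Nat.mod_mul_right_div_self]
  have h1 : 1 ≤ n / p ^ W := (Nat.one_le_div_iff hP).2 hn
  have h1' : 1 ≤ n' / p ^ W := by rw [hdiv]; omega
  have hm : ((n / p ^ W : ℕ) : ℤ) ≡ (n' / p ^ W : ℕ) [ZMOD p] := by
    rw [Int.natCast_modEq_iff, hdiv, Nat.ModEq]
    simp
  have e1 := ha.sub_eq hg hp W _ _ (n % p ^ W) h1 h1' hm (Nat.mod_lt _ hP)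
  have e2 := ha.sub_eq hg hp W _ _ (n % p ^ W + r) h1 h1' hm hgood
  rw [← add_assoc, Nat.div_add_mod, ← hmodn, ← add_assoc, Nat.div_add_mod] at e2
  rw [Nat.div_add_mod, ← hmodn, Nat.div_add_mod] at e1
  linarith

/-! ### Combining the bases: mixed radix weights and the Chinese remainder theorem. -/

theorem weight_zero {d : ℕ} (p : Fin (d + 1) → ℕ) : weight p 0 = 1 := by
  have : Finset.Iio (0 : Fin (d + 1)) = ∅ := by ext x; simp
  rw [weight, this, Finset.prod_empty]

theorem weight_succ {d : ℕ} (p : Fin (d + 1) → ℕ) (i : Fin d) :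
    weight p i.succ = p 0 * weight (fun j => p j.succ) i := by
  have : Finset.Iio i.succ = Finset.cons 0 ((Finset.Iio i).map (Fin.succEmb d)) (by simp) := by
    ext x
    refine Fin.cases ?_ (fun x => ?_) x <;> simp
  rw [weight, this, Finset.prod_cons, Finset.prod_map]
  rfl

/-- If each `b i` is equidistributed modulo `p i` with respect to the weight `w i`, then
`∑ i, weight p i * b i` is equidistributed modulo `∏ i, p i` with respect to the product weight. -/
theorem sum_weight_equidistributed : ∀ {d : ℕ} (p : Fin d → ℕ), (∀ i, 0 < p i) →
    ∀ (α : Fin d → Type) [∀ i, Fintype (α i)] (w : ∀ i, α i → ℝ) (b : ∀ i, α i → ℤ),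
    (∀ i (z : ℤ), (∑ x, w i x * (if (p i : ℤ) ∣ b i x - z then 1 else 0)) * p i =
      ∑ x, w i x) →
    ∀ z : ℤ, (∑ x : (∀ i, α i), (∏ i, w i (x i)) *
      (if ((∏ i, p i : ℕ) : ℤ) ∣ ∑ i, (weight p i : ℤ) * b i (x i) - z then 1 else 0)) *
        ((∏ i, p i : ℕ) : ℝ) = ∑ x : (∀ i, α i), ∏ i, w i (x i) := by
  intro d
  induction d with
  | zero => intro p hp α _ w b h z; simp
  | succ d ih =>
    intro p hp α _ w b h z
    have ih' := ih (fun i => p i.succ) (fun i => hp _) (fun i => α i.succ)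
      (fun i => w i.succ) (fun i => b i.succ) (fun i => h i.succ)
    set k' := ∏ i : Fin d, p i.succ with hk'
    set T := ∑ x : (∀ i : Fin d, α i.succ), ∏ i, w i.succ (x i) with hT
    have hp0 : (p 0 : ℤ) ≠ 0 := by exact_mod_cast (hp 0).ne'
    -- All later weights are multiples of `p 0`, so the first coordinate alone decides divisibility
    -- by `p 0`. The quotient then shifts the target for the others, which is why the induction
    -- needs every `z`.
    have hdvd : ∀ (x₀ : α 0) (x : ∀ i : Fin d, α i.succ),
        (((p 0 * k' : ℕ) : ℤ) ∣ b 0 x₀ + ∑ i : Fin d, (weight p i.succ : ℤ) * b i.succ (x i) - z)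
        ↔ (p 0 : ℤ) ∣ b 0 x₀ - z ∧ (k' : ℤ) ∣
          ∑ i, (weight (fun j => p j.succ) i : ℤ) * b i.succ (x i) - (z - b 0 x₀) / p 0 := by
      intro x₀ x
      have hsum : ∑ i : Fin d, (weight p i.succ : ℤ) * b i.succ (x i) =
          p 0 * ∑ i, (weight (fun j => p j.succ) i : ℤ) * b i.succ (x i) := by
        rw [Finset.mul_sum]
        refine Finset.sum_congr rfl fun i _ => ?_
        rw [weight_succ]
        push_cast
        ring
      rw [hsum]
      set S := ∑ i, (weight (fun j => p j.succ) i : ℤ) * b i.succ (x i)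
      by_cases hb : (p 0 : ℤ) ∣ b 0 x₀ - z
      · obtain ⟨t, ht⟩ := hb
        have h1 : b 0 x₀ + p 0 * S - z = p 0 * (S + t) := by linarith
        have h2 : z - b 0 x₀ = p 0 * (-t) := by linarith
        rw [h1, h2, Int.mul_ediv_cancel_left _ hp0]
        push_cast
        rw [mul_dvd_mul_iff_left hp0, sub_neg_eq_add]
        exact ⟨fun h => ⟨⟨t, ht⟩, h⟩, fun h => h.2⟩
      · refine ⟨fun h => absurd ?_ hb, fun h => absurd h.1 hb⟩
        have h1 : (p 0 : ℤ) ∣ b 0 x₀ + p 0 * S - z :=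
          (Dvd.intro (k' : ℤ) (by push_cast; rfl)).trans h
        have h2 : b 0 x₀ - z = (b 0 x₀ + p 0 * S - z) - p 0 * S := by ring
        rw [h2]
        exact dvd_sub h1 (dvd_mul_right _ _)
    rw [← (Fin.consEquiv α).sum_comp, ← (Fin.consEquiv α).sum_comp,
      Fintype.sum_prod_type, Fintype.sum_prod_type]
    simp only [Fin.consEquiv_apply, Fin.prod_univ_succ, Fin.sum_univ_succ, Fin.cons_zero,
      Fin.cons_succ, weight_zero, Nat.cast_one, one_mul, ← hk']
    have hinner : ∀ x₀ : α 0, (∑ x : (∀ i : Fin d, α i.succ),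
        w 0 x₀ * (∏ i, w i.succ (x i)) * (if ((p 0 * k' : ℕ) : ℤ) ∣ b 0 x₀ +
          ∑ i : Fin d, (weight p i.succ : ℤ) * b i.succ (x i) - z then (1 : ℝ) else 0)) * k' =
        w 0 x₀ * (if (p 0 : ℤ) ∣ b 0 x₀ - z then 1 else 0) * T := by
      intro x₀
      simp_rw [hdvd]
      rw [← ih' ((z - b 0 x₀) / p 0), ← mul_assoc, Finset.mul_sum]
      congr 1
      refine Finset.sum_congr rfl fun x _ => ?_
      by_cases h1 : (p 0 : ℤ) ∣ b 0 x₀ - z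
      · simp only [h1, true_and]; simp
      · simp [h1]
    rw [Nat.cast_mul (α := ℝ), mul_comm (p 0 : ℝ), ← mul_assoc, Finset.sum_mul]
    simp_rw [hinner, ← Finset.mul_sum]
    rw [← Finset.sum_mul, ← Finset.sum_mul, ← h 0 z]
    ring

/-- Summation over a complete residue system, by the Chinese remainder theorem. -/
theorem sum_range_prod_eq {d : ℕ} (q : Fin d → ℕ) (hq : ∀ i, 0 < q i)
    (hco : Pairwise fun i j => (q i).Coprime (q j)) (F : (∀ i, Fin (q i)) → ℝ) :
    ∑ n ∈ Finset.range (∏ i, q i), F (fun i => ⟨n % q i, Nat.mod_lt _ (hq i)⟩) = ∑ x, F x := by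
  rw [Finset.sum_range]
  refine Function.Bijective.sum_comp (e := fun n : Fin (∏ i, q i) => fun i =>
    (⟨n % q i, Nat.mod_lt _ (hq i)⟩ : Fin (q i))) ?_ F
  rw [Fintype.bijective_iff_injective_and_card]
  refine ⟨fun m n hmn => ?_, by simp⟩
  have h : ((∏ i, q i : ℕ) : ℤ) ∣ (n : ℕ) - (m : ℕ) := by
    push_cast
    refine Finset.prod_dvd_of_coprime (fun i _ j _ hij => ?_) fun i _ => ?_
    · exact Nat.isCoprime_iff_coprime.2 (hco hij)
    · exact Nat.modEq_iff_dvd.1 (Fin.ext_iff.1 (congrFun hmn i))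
  exact Fin.ext ((Nat.modEq_iff_dvd.2 h).eq_of_lt_of_lt m.2 n.2)

/-! ### Long carries and exact counts over blocks. -/

/-- The number of `n < N` whose residue modulo `P` is at least `P - r`. -/
theorem sum_not_lt_le (P r N : ℕ) (hP : 0 < P) :
    ∑ n ∈ Finset.range N, (if n % P + r < P then (0 : ℝ) else 1) ≤ r * (N / P + 1) := by
  have hNP : N ≤ P * (N / P + 1) := by
    have := Nat.div_add_mod N P
    have := Nat.mod_lt N hP
    nlinarith
  have hblock : ∑ x ∈ Finset.range P, (if x + r < P then (0 : ℝ) else 1) ≤ r := by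
    have : ∑ x ∈ Finset.range P, (if x + r < P then (0 : ℝ) else 1) =
        ((Finset.range P).filter fun x => ¬ x + r < P).card := by
      rw [Finset.card_filter]
      push_cast
      refine Finset.sum_congr rfl fun x _ => ?_
      by_cases h : x + r < P <;> simp [h]
    rw [this]
    have hsub : ((Finset.range P).filter fun x => ¬ x + r < P) ⊆ Finset.Ico (P - r) P := by
      intro x
      simp only [Finset.mem_filter, Finset.mem_range, Finset.mem_Ico]
      omega
    have := Finset.card_le_card hsub
    rw [Nat.card_Ico] at this
    exact_mod_cast this.trans (by omega)
  calc ∑ n ∈ Finset.range N, (if n % P + r < P then (0 : ℝ) else 1)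
      ≤ ∑ n ∈ Finset.range (P * (N / P + 1)), (if n % P + r < P then (0 : ℝ) else 1) := by
        refine Finset.sum_le_sum_of_subset_of_nonneg (Finset.range_subset_range.2 hNP) ?_
        intro i _ _
        split_ifs <;> norm_num
    _ = ∑ y ∈ Finset.range (N / P + 1), ∑ x ∈ Finset.range P,
          (if x + r < P then (0 : ℝ) else 1) := by
        rw [sum_range_mul_eq]
        refine Finset.sum_congr rfl fun y _ => Finset.sum_congr rfl fun x hx => ?_
        rw [Nat.mul_add_mod, Nat.mod_eq_of_lt (Finset.mem_range.1 hx)]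
    _ ≤ ((N / P : ℕ) + 1) * r := by
        rw [Finset.sum_const, Finset.card_range, nsmul_eq_mul]
        push_cast
        gcongr
    _ ≤ r * (N / P + 1) := by
        rw [mul_comm]
        gcongr
        exact Nat.cast_div_le

theorem combined_eq_iff {d : ℕ} (p : Fin d → ℕ) (a : Fin d → ℕ → ℤ) (m n : ℕ) :
    combined p a m = combined p a n ↔
      ((∏ i, p i : ℕ) : ℤ) ∣ ∑ i, (weight p i : ℤ) * (a i n - a i m) := by
  simp_rw [mul_sub, Finset.sum_sub_distrib]
  exact Int.modEq_iff_dvd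

/-- The indicator of the `n` for which adding `r` does not carry past digit `W i` in base `p i`,
for every `i`. -/
noncomputable def noCarry {d : ℕ} (p W : Fin d → ℕ) (r n : ℕ) : ℝ :=
  ∏ i, if n % p i ^ W i + r < p i ^ W i then 1 else 0

theorem noCarry_eq_zero_or_one {d : ℕ} (p W : Fin d → ℕ) (r n : ℕ) :
    noCarry p W r n = 1 ∧ (∀ i, n % p i ^ W i + r < p i ^ W i) ∨
      noCarry p W r n = 0 ∧ ∃ i, ¬ n % p i ^ W i + r < p i ^ W i := by
  by_cases h : ∀ i, n % p i ^ W i + r < p i ^ W i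
  · left
    exact ⟨by simp [noCarry, h], h⟩
  · right
    push Not at h
    obtain ⟨i, hi⟩ := h
    exact ⟨Finset.prod_eq_zero (Finset.mem_univ i) (by simp [hi]), i, by simpa using hi⟩

/-- A union bound over the bases. -/
theorem one_sub_noCarry_le {d : ℕ} (p W : Fin d → ℕ) (r n : ℕ) :
    1 - noCarry p W r n ≤ ∑ i, if n % p i ^ W i + r < p i ^ W i then (0 : ℝ) else 1 := by
  have hnn : ∀ i ∈ Finset.univ, (0 : ℝ) ≤ if n % p i ^ W i + r < p i ^ W i then 0 else 1 :=
    fun i _ => by split_ifs <;> norm_num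
  rcases noCarry_eq_zero_or_one p W r n with ⟨h, _⟩ | ⟨h, i, hi⟩
  · rw [h, sub_self]
    exact Finset.sum_nonneg hnn
  · rw [h, sub_zero]
    refine le_trans ?_ (Finset.single_le_sum hnn (Finset.mem_univ i))
    simp [hi]

/-- Over a block of length `∏ i, p i ^ (W i + 1)`, the proportion of coincidences among the `n`
without long carries is exactly `1 / ∏ i, p i`. -/
theorem sum_block_eq {d : ℕ} {p : Fin d → ℕ} (hp : ∀ i, (p i).Prime)
    (hinj : Function.Injective p) {g : (i : Fin d) → Fin (p i) → ℤ → ℤ} {a : Fin d → ℕ → ℤ}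
    (hg : ∀ i, Admissible (p i) (g i)) (ha : ∀ i, DigitRecursion (p i) (g i) (a i))
    (W : Fin d → ℕ) {r : ℕ} (hr : 1 ≤ r) {v : ℕ} (hv : 1 ≤ v) :
    (∑ x ∈ Finset.range (∏ i, p i ^ W i * p i),
      noCarry p W r ((∏ i, p i ^ W i * p i) * v + x) *
        (if combined p a ((∏ i, p i ^ W i * p i) * v + x) =
          combined p a ((∏ i, p i ^ W i * p i) * v + x + r) then 1 else 0)) *
      ((∏ i, p i : ℕ) : ℝ) =
    ∑ x ∈ Finset.range (∏ i, p i ^ W i * p i),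
      noCarry p W r ((∏ i, p i ^ W i * p i) * v + x) := by
  set q : Fin d → ℕ := fun i => p i ^ W i * p i with hq
  set Q := ∏ i, q i with hQ
  have hp0 : ∀ i, 0 < p i := fun i => (hp i).pos
  have hq0 : ∀ i, 0 < q i := fun i => Nat.mul_pos (pow_pos (hp0 i) _) (hp0 i)
  have hco : Pairwise fun i j => (q i).Coprime (q j) := by
    intro i j hij
    simp only [hq, ← pow_succ]
    exact Nat.Coprime.pow _ _ ((Nat.coprime_primes (hp i) (hp j)).2 (hinj.ne hij))
  set w : ∀ i, Fin (q i) → ℝ := fun i x =>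
    if (x : ℕ) % p i ^ W i + r < p i ^ W i then 1 else 0 with hw
  set b : ∀ i, Fin (q i) → ℤ := fun i x => a i (q i * 1 + x + r) - a i (q i * 1 + x) with hb
  have main := sum_weight_equidistributed p hp0 (fun i => Fin (q i)) w b (fun i z => by
    have := (ha i).equidistributed (hg i) (hp0 i) hr z (W i) 1 le_rfl
    rwa [Finset.sum_range, Finset.sum_range] at this) 0
  rw [← sum_range_prod_eq q hq0 hco, ← sum_range_prod_eq q hq0 hco] at main
  have hmod : ∀ x i, (Q * v + x) % q i = x % q i := by
    intro x i
    obtain ⟨t, ht⟩ := Finset.dvd_prod_of_mem q (Finset.mem_univ i)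
    rw [hQ, ht, mul_assoc, Nat.mul_add_mod]
  have hmod' : ∀ x i, (Q * v + x) % p i ^ W i = x % q i % p i ^ W i := by
    intro x i
    rw [← hmod, Nat.mod_mul_right_mod]
  have hwprod : ∀ x, ∏ i, w i ⟨x % q i, Nat.mod_lt _ (hq0 i)⟩ = noCarry p W r (Q * v + x) := by
    intro x
    simp only [hw, noCarry, hmod']
  simp_rw [hwprod] at main
  rw [← main]
  congr 1
  refine Finset.sum_congr rfl fun x _ => ?_
  rcases noCarry_eq_zero_or_one p W r (Q * v + x) with ⟨_, h⟩ | ⟨h, _⟩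
  · have hinc : ∀ i, a i (Q * v + x + r) - a i (Q * v + x) =
        b i ⟨x % q i, Nat.mod_lt _ (hq0 i)⟩ := by
      intro i
      have hle : p i ^ W i ≤ Q * v + x := by
        have h1 : p i ^ W i ≤ q i := Nat.le_mul_of_pos_right _ (hp0 i)
        have h2 : q i ≤ Q := Nat.le_of_dvd (Finset.prod_pos fun i _ => hq0 i)
          (Finset.dvd_prod_of_mem q (Finset.mem_univ i))
        nlinarith
      have := (ha i).increment_eq (hg i) (hp0 i) hle (h i)
      rw [this]
      simp only [hb]
      rw [← hmod x i]
    simp only [combined_eq_iff, hinc, sub_zero]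
  · simp [h]

/-! ### From complete blocks to arbitrary ranges. -/

/-- Block `0` is exempt because the initial values of the sequences are arbitrary. It and the final
incomplete block cost at most `Q` each. -/
theorem abs_sum_range_le_of_block_sum_eq_zero {f : ℕ → ℝ} {Q : ℕ} (hQ : 0 < Q)
    (hf : ∀ n, |f n| ≤ 1)
    (hblock : ∀ v, 1 ≤ v → ∑ x ∈ Finset.range Q, f (Q * v + x) = 0) (N : ℕ) :
    |∑ n ∈ Finset.range N, f n| ≤ 2 * Q := by
  have hle : ∀ (c m : ℕ), |∑ x ∈ Finset.range m, f (c + x)| ≤ m := by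
    intro c m
    refine (Finset.abs_sum_le_sum_abs _ _).trans ?_
    refine (Finset.sum_le_sum fun x _ => hf _).trans ?_
    simp
  rw [← Nat.div_add_mod N Q, Finset.sum_range_add, sum_range_mul_eq]
  have h1 : |∑ y ∈ Finset.range (N / Q), ∑ x ∈ Finset.range Q, f (Q * y + x)| ≤ Q := by
    cases N / Q with
    | zero => simp
    | succ c =>
      rw [Finset.sum_range_succ', Finset.sum_eq_zero fun y _ => hblock (y + 1) (by omega),
        zero_add]
      exact hle _ _
  have h2 := hle (Q * (N / Q)) (N % Q)
  have h3 : ((N % Q : ℕ) : ℝ) ≤ Q := by exact_mod_cast (Nat.mod_lt N hQ).le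
  have := abs_add_le (∑ y ∈ Finset.range (N / Q), ∑ x ∈ Finset.range Q, f (Q * y + x))
    (∑ x ∈ Finset.range (N % Q), f (Q * (N / Q) + x))
  linarith

/-- The sums differ by `s` terms at each end. This reduces the correlation to `r₁ = 0`. -/
theorem abs_sum_range_shift_sub_le {f : ℕ → ℝ} (hf : ∀ n, |f n| ≤ 1) (s N : ℕ) :
    |∑ n ∈ Finset.range N, f (n + s) - ∑ n ∈ Finset.range N, f n| ≤ 2 * s := by
  have hle : ∀ c : ℕ, |∑ x ∈ Finset.range s, f (c + x)| ≤ s := by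
    intro c
    refine (Finset.abs_sum_le_sum_abs _ _).trans ?_
    refine (Finset.sum_le_sum fun x _ => hf _).trans ?_
    simp
  have h1 := Finset.sum_range_add f N s
  have h2 := Finset.sum_range_add f s N
  have h3 : ∑ n ∈ Finset.range N, f (n + s) = ∑ n ∈ Finset.range N, f (s + n) := by
    simp_rw [add_comm]
  rw [add_comm s N] at h2
  have h4 := hle N
  have h5 := hle 0
  simp only [zero_add] at h5
  have : ∑ n ∈ Finset.range N, f (n + s) - ∑ n ∈ Finset.range N, f n =
      ∑ x ∈ Finset.range s, f (N + x) - ∑ x ∈ Finset.range s, f x := by linarith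
  rw [this]
  have := abs_sub (∑ x ∈ Finset.range s, f (N + x)) (∑ x ∈ Finset.range s, f x)
  linarith

theorem abs_delta_sub_le (x : ℕ → ℤ) (i j : ℕ) {k : ℕ} (hk : 1 ≤ k) :
    |(delta x i j : ℝ) - (1 - 1 / (k : ℝ))| ≤ 1 := by
  have h1 : (1 : ℝ) ≤ k := by exact_mod_cast hk
  have h2 : 1 / (k : ℝ) ≤ 1 := by rw [div_le_one (by linarith)]; exact h1
  have h3 : 0 ≤ 1 / (k : ℝ) := by positivity
  unfold delta
  rw [abs_le]
  split_ifs <;> push_cast <;> constructor <;> linarith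

/-- Discrepancy of the order two correlation with lag `r`, for arbitrary window lengths `W i`. -/
theorem abs_sum_delta_sub_le {d : ℕ} {p : Fin d → ℕ} (hp : ∀ i, (p i).Prime)
    (hinj : Function.Injective p) {g : (i : Fin d) → Fin (p i) → ℤ → ℤ} {a : Fin d → ℕ → ℤ}
    (hg : ∀ i, Admissible (p i) (g i)) (ha : ∀ i, DigitRecursion (p i) (g i) (a i))
    (W : Fin d → ℕ) {r : ℕ} (hr : 1 ≤ r) (N : ℕ) :
    |∑ n ∈ Finset.range N,
        ((delta (combined p a) n (n + r) : ℝ) - (1 - 1 / ((∏ i, p i : ℕ) : ℝ)))| ≤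
      2 * ((∏ i, p i ^ W i * p i : ℕ) : ℝ) + ∑ i, (r : ℝ) * (N / ((p i ^ W i : ℕ) : ℝ) + 1) := by
  have hk : 0 < ∏ i, p i := Finset.prod_pos fun i _ => (hp i).pos
  set k := ∏ i, p i with hk_def
  set Q := ∏ i, p i ^ W i * p i with hQ_def
  have hQ : 0 < Q :=
    Finset.prod_pos fun i _ => Nat.mul_pos (pow_pos (hp i).pos _) (hp i).pos
  set f : ℕ → ℝ := fun n => (delta (combined p a) n (n + r) : ℝ) - (1 - 1 / (k : ℝ)) with hf
  have hf1 : ∀ n, |f n| ≤ 1 := fun n => abs_delta_sub_le _ _ _ hk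
  have hw : ∀ n, 0 ≤ noCarry p W r n ∧ noCarry p W r n ≤ 1 := fun n => by
    rcases noCarry_eq_zero_or_one p W r n with ⟨h, _⟩ | ⟨h, _⟩ <;> rw [h] <;> norm_num
  have h1 : |∑ n ∈ Finset.range N, noCarry p W r n * f n| ≤ 2 * Q := by
    refine abs_sum_range_le_of_block_sum_eq_zero hQ (fun n => ?_) (fun v hv => ?_) N
    · rw [abs_mul, abs_of_nonneg (hw n).1]
      exact mul_le_one₀ (hw n).2 (abs_nonneg _) (hf1 n)
    · have hblock := sum_block_eq hp hinj hg ha W hr hv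
      have hfe : ∀ n, f n =
          1 / (k : ℝ) - if combined p a n = combined p a (n + r) then 1 else 0 := by
        intro n
        simp only [hf, delta]
        split_ifs <;> push_cast <;> ring
      simp_rw [hfe, mul_sub, Finset.sum_sub_distrib, ← Finset.sum_mul]
      rw [← hblock]
      have : (k : ℝ) ≠ 0 := by exact_mod_cast hk.ne'
      rw [mul_one_div, mul_div_assoc, div_self this, mul_one, sub_self]
  have h2 : |∑ n ∈ Finset.range N, (1 - noCarry p W r n) * f n| ≤
      ∑ i, (r : ℝ) * (N / ((p i ^ W i : ℕ) : ℝ) + 1) := by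
    calc _ ≤ ∑ n ∈ Finset.range N, |(1 - noCarry p W r n) * f n| :=
          Finset.abs_sum_le_sum_abs _ _
      _ ≤ ∑ n ∈ Finset.range N, ∑ i, (if n % p i ^ W i + r < p i ^ W i then (0 : ℝ) else 1) := by
          refine Finset.sum_le_sum fun n _ => ?_
          rw [abs_mul, abs_of_nonneg (sub_nonneg.2 (hw n).2)]
          exact (mul_le_of_le_one_right (sub_nonneg.2 (hw n).2) (hf1 n)).trans
            (one_sub_noCarry_le p W r n)
      _ = ∑ i, ∑ n ∈ Finset.range N, (if n % p i ^ W i + r < p i ^ W i then (0 : ℝ) else 1) :=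
          Finset.sum_comm
      _ ≤ _ := Finset.sum_le_sum fun i _ => sum_not_lt_le _ _ _ (pow_pos (hp i).pos _)
  have h3 : ∑ n ∈ Finset.range N, f n = ∑ n ∈ Finset.range N, noCarry p W r n * f n +
      ∑ n ∈ Finset.range N, (1 - noCarry p W r n) * f n := by
    rw [← Finset.sum_add_distrib]
    exact Finset.sum_congr rfl fun n _ => by ring
  rw [h3]
  exact (abs_add_le _ _).trans (add_le_add h1 h2)

end RudinShapiro

/-! ### Choice of the window lengths. -/

open RudinShapiro in
theorem theorem6 (k : ℕ) :
    ∃ C : ℝ, 0 < C ∧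
      ∀ (d : ℕ) (p : Fin d → ℕ), 2 ≤ d → (∀ i, (p i).Prime) → Function.Injective p →
        k = ∏ i, p i →
      ∀ (g : (i : Fin d) → Fin (p i) → ℤ → ℤ) (a : Fin d → ℕ → ℤ),
        (∀ i, RudinShapiro.Admissible (p i) (g i)) →
        (∀ i, RudinShapiro.DigitRecursion (p i) (g i) (a i)) →
      ∀ (γ : ℝ), 0 < γ → γ < 1 →
      ∀ (r₁ r₂ N : ℕ), r₁ < r₂ →
        |((∑ n ∈ Finset.range N,
              RudinShapiro.delta (RudinShapiro.combined p a) (n + r₁) (n + r₂) : ℕ) : ℝ)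
            - (1 - 1 / (k : ℝ)) * (N : ℝ)| ≤
          C * (((r₂ : ℝ) - (r₁ : ℝ)) * (N : ℝ) ^ (1 - γ / (d : ℝ))
            + ((r₂ : ℝ) - (r₁ : ℝ)) * (N : ℝ) ^ (1 - γ)
                * Real.posLog ((N : ℝ) ^ (γ / (d : ℝ)) / ((r₂ : ℝ) - (r₁ : ℝ)))
            + (N : ℝ) ^ γ + (r₁ : ℝ)) := by
  -- Dominates the coefficients `2`, `2 * k` and `k * (k + 1)` arising from the shift, the blocks
  -- and the long carries.
  refine ⟨2 * ((k : ℝ) + 1) ^ 2, by positivity, ?_⟩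
  intro d p hd hp hinj hk g a hg ha γ hγ0 hγ1 r₁ r₂ N hr
  obtain ⟨r, rfl⟩ := Nat.exists_eq_add_of_lt hr
  set R : ℕ := r + 1 with hR
  have hcast : ((r₁ + r + 1 : ℕ) : ℝ) - (r₁ : ℝ) = R := by rw [hR]; push_cast; ring
  rw [hcast]
  set L := (R : ℝ) * (N : ℝ) ^ (1 - γ) * Real.posLog ((N : ℝ) ^ (γ / (d : ℝ)) / (R : ℝ))
  have hL : 0 ≤ L := mul_nonneg (by positivity) Real.posLog_nonneg
  have hlhs : ((∑ n ∈ Finset.range N,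
      delta (combined p a) (n + r₁) (n + (r₁ + r + 1)) : ℕ) : ℝ) - (1 - 1 / (k : ℝ)) * (N : ℝ) =
      ∑ n ∈ Finset.range N,
        ((delta (combined p a) (n + r₁) (n + r₁ + R) : ℝ) - (1 - 1 / (k : ℝ))) := by
    rw [Finset.sum_sub_distrib, Finset.sum_const, Finset.card_range, nsmul_eq_mul]
    push_cast
    rw [mul_comm (N : ℝ)]
    congr 1
    refine Finset.sum_congr rfl fun n _ => ?_
    rw [show n + (r₁ + r + 1) = n + r₁ + R by omega]
  rw [hlhs]
  rcases Nat.eq_zero_or_pos N with rfl | hN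
  · simp only [Finset.range_zero, Finset.sum_empty, abs_zero]
    positivity
  have hdR : (0 : ℝ) < d := by exact_mod_cast (by omega : 0 < d)
  have hN1 : (1 : ℝ) ≤ N := by exact_mod_cast hN
  have hN0 : (0 : ℝ) < N := by linarith
  have hk1 : 1 ≤ k := hk ▸ Finset.prod_pos fun i _ => (hp i).pos
  have hdk : (d : ℝ) ≤ k := by
    have : 2 ^ d ≤ k := by
      rw [hk]
      calc 2 ^ d = ∏ _i : Fin d, 2 := by simp
        _ ≤ _ := Finset.prod_le_prod' fun i _ => (hp i).two_le
    exact_mod_cast (Nat.lt_two_pow_self.le.trans this)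
  have hpk : ∀ i, (p i : ℝ) ≤ k := fun i => by
    exact_mod_cast Nat.le_of_dvd hk1 (hk ▸ Finset.dvd_prod_of_mem p (Finset.mem_univ i))
  set X : ℝ := (N : ℝ) ^ (γ / (d : ℝ)) with hX
  have hX1 : 1 ≤ X := Real.one_le_rpow hN1 (by positivity)
  have hXd : X ^ d = (N : ℝ) ^ γ := by
    rw [hX, ← Real.rpow_natCast, ← Real.rpow_mul hN0.le, div_mul_cancel₀ _ hdR.ne']
  have hNX : (N : ℝ) / X = (N : ℝ) ^ (1 - γ / (d : ℝ)) := by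
    rw [Real.rpow_sub hN0, Real.rpow_one]
  set Y : ℝ := (N : ℝ) ^ (1 - γ / (d : ℝ)) with hY
  -- Lets `Y` absorb the `+ 1` in the count of long carries.
  have hY1 : 1 ≤ Y := by
    apply Real.one_le_rpow hN1
    rw [sub_nonneg, div_le_one hdR]
    have : (2 : ℝ) ≤ d := by exact_mod_cast hd
    linarith
  -- The largest power of `p i` not exceeding `X`: the upper bound gives a block length at most `k *
  -- X ^ d`, and the lower bound `X ≤ p i ^ W i * p i` makes long carries rare.
  set W : Fin d → ℕ := fun i => Nat.log (p i) ⌊X⌋₊ with hW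
  have hfloor : ⌊X⌋₊ ≠ 0 := (Nat.floor_pos.2 hX1).ne'
  have hWle : ∀ i, ((p i ^ W i : ℕ) : ℝ) ≤ X := fun i =>
    (Nat.cast_le.2 (Nat.pow_log_le_self _ hfloor)).trans (Nat.floor_le (by linarith))
  have hWlt : ∀ i, X ≤ ((p i ^ W i : ℕ) : ℝ) * p i := fun i => by
    have h1 := Nat.lt_pow_succ_log_self (hp i).one_lt ⌊X⌋₊
    have h2 := (Nat.lt_of_floor_lt h1).le
    rw [pow_succ] at h2
    exact_mod_cast h2
  have hQ : ((∏ i, p i ^ W i * p i : ℕ) : ℝ) ≤ k * (N : ℝ) ^ γ := by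
    rw [Finset.prod_mul_distrib, ← hk, Nat.cast_mul, mul_comm, ← hXd]
    gcongr
    rw [Nat.cast_prod]
    calc _ ≤ ∏ _i : Fin d, X :=
          Finset.prod_le_prod (fun i _ => by positivity) fun i _ => hWle i
      _ = X ^ d := by simp
  have hbad : ∑ i, (R : ℝ) * (N / ((p i ^ W i : ℕ) : ℝ) + 1) ≤ k * (k + 1) * (R * Y) := by
    calc _ ≤ ∑ _i : Fin d, (R : ℝ) * (k * Y + Y) := by
          refine Finset.sum_le_sum fun i _ => ?_
          have hPpos : (0 : ℝ) < ((p i ^ W i : ℕ) : ℝ) := by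
            exact_mod_cast pow_pos (hp i).pos _
          have : (N : ℝ) / ((p i ^ W i : ℕ) : ℝ) ≤ k * Y := by
            rw [← hNX, ← mul_div_assoc, div_le_div_iff₀ hPpos (by linarith)]
            have h1 : X ≤ k * ((p i ^ W i : ℕ) : ℝ) := by
              nlinarith [hWlt i, hpk i]
            nlinarith
          gcongr
      _ = d * (k + 1) * (R * Y) := by simp; ring
      _ ≤ _ := by gcongr
  have hmain := abs_sum_delta_sub_le hp hinj hg ha W (by omega : 1 ≤ R) N
  rw [← hk] at hmain
  have hshift := abs_sum_range_shift_sub_le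
    (f := fun n => (delta (combined p a) n (n + R) : ℝ) - (1 - 1 / (k : ℝ)))
    (fun n => abs_delta_sub_le _ _ _ hk1) r₁ N
  set S := ∑ n ∈ Finset.range N,
    ((delta (combined p a) n (n + R) : ℝ) - (1 - 1 / (k : ℝ)))
  set S' := ∑ n ∈ Finset.range N,
    ((delta (combined p a) (n + r₁) (n + r₁ + R) : ℝ) - (1 - 1 / (k : ℝ)))
  have htri : |S'| ≤ |S' - S| + |S| := by
    simpa using abs_add_le (S' - S) S
  have hkR : (0 : ℝ) ≤ k := by positivity
  have hZ : 0 ≤ (N : ℝ) ^ γ := by positivity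
  have hRY : 0 ≤ (R : ℝ) * Y := by positivity
  have hr₁ : (0 : ℝ) ≤ r₁ := by positivity
  calc |S'| ≤ 2 * r₁ + (2 * (k * (N : ℝ) ^ γ) + k * (k + 1) * (R * Y)) := by linarith
    _ ≤ 2 * ((k : ℝ) + 1) ^ 2 * (R * Y + 0 + (N : ℝ) ^ γ + r₁) := by
        have e1 : 2 * (r₁ : ℝ) ≤ 2 * ((k : ℝ) + 1) ^ 2 * r₁ :=
          mul_le_mul_of_nonneg_right (by nlinarith) hr₁
        have e2 : 2 * (k : ℝ) * (N : ℝ) ^ γ ≤ 2 * ((k : ℝ) + 1) ^ 2 * (N : ℝ) ^ γ :=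
          mul_le_mul_of_nonneg_right (by nlinarith) hZ
        have e3 : (k : ℝ) * (k + 1) * (R * Y) ≤ 2 * ((k : ℝ) + 1) ^ 2 * (R * Y) :=
          mul_le_mul_of_nonneg_right (by nlinarith) hRY
        linarith
    _ ≤ _ := by gcongr
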